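/- Let $c,d$ be relatively prime integers with $0\le c\le d$, and let $\mathbb P$ be the rider with the single basic move $(c,d)$: a piece at $z\in\mathbb Z^2$ attacks $w\in\mathbb Z^2$ if $w-z$ is an integral multiple of $(c,d)$. For integers $q\ge 2$ and $n\ge 0$ let $u_{\mathbb P}(q;n)$ be the number of ways to place $q$ indistinguishable copies of $\mathbb P$ on distinct squares of the $n\times n$ board $\{1,\dots,n\}^2$ so that no piece attacks another one. Then, for every $q\ge2$, $u_{\mathbb P}(q;n)$ is a quasipolynomial function of $n$, $$u_{\mathbb P}(q;n)=\gamma_0(n)n^{2q}+\gamma_1(n)n^{2q-1}+\cdots+\gamma_{2q}(n)n^0\qquad(n\ge 0),$$ with rational coefficients $\gamma_i(n)$ that are periodic functions of $n$ (depending on $q$, $c$, $d$), and for every such expansion the smallest period of $\gamma_3$ is exactly $d$, and the periodic part of $\gamma_3$ is $$-\frac{1}{(q-2)!}\,\frac{\bar n(d-\bar n)(d-c)}{2d^2},\qquad \bar n:=n\bmod d\in\{0,1,\dots,d-1\};$$ that is, there is a constant $K$ (depending only on $q,c,d$) such that $\gamma_3(n)=K-\frac{1}{(q-2)!}\frac{\bar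 n(d-\bar n)(d-c)}{2d^2}$ for all $n$. -/

import Mathlib

/-- The `n × n` chessboard `[n]²`, as a set of integral points. -/
noncomputable def board (n : ℕ) : Finset (ℤ × ℤ) :=
  Finset.Icc (1 : ℤ) (n : ℤ) ×ˢ Finset.Icc (1 : ℤ) (n : ℤ)

/-- A rider with set `M` of basic moves, standing on `z`, attacks `w` if `w - z` is an integral
multiple of a basic move. -/
def Attacks (M : Set (ℤ × ℤ)) (z w : ℤ × ℤ) : Prop :=
  ∃ m ∈ M, ∃ k : ℤ, w - z = k • m

/-- A placement of indistinguishable pieces on distinct squares is nonattacking if no piece attacks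
another one. -/
def Nonattacking (M : Set (ℤ × ℤ)) (S : Finset (ℤ × ℤ)) : Prop :=
  ∀ z ∈ S, ∀ w ∈ S, z ≠ w → ¬ Attacks M z w

open Classical in
/-- `u_P(q;n)`: the number of nonattacking placements of `q` indistinguishable copies of the rider
with set `M` of basic moves on the `n × n` board. -/
noncomputable def numNonattacking (M : Set (ℤ × ℤ)) (q n : ℕ) : ℕ :=
  (((board n).powersetCard q).filter (fun S => Nonattacking M S)).card

/-- `γ 0, …, γ D` are the coefficients of `f` as a quasipolynomial of degree at most `D`:
each `γ i` is a periodic function of `n`, and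
`f n = γ 0 n * n ^ D + γ 1 n * n ^ (D - 1) + ⋯ + γ D n`. -/
def IsQuasipolynomialExpansion (f : ℕ → ℚ) (D : ℕ) (γ : ℕ → ℕ → ℚ) : Prop :=
  (∀ i ≤ D, ∃ p : ℕ, 0 < p ∧ Function.Periodic (γ i) p) ∧
    ∀ n : ℕ, f n = ∑ i ∈ Finset.range (D + 1), γ i n * (n : ℚ) ^ (D - i)

/-- The (smallest) period of `g` is exactly `p`. -/
def HasExactPeriod (g : ℕ → ℚ) (p : ℕ) : Prop :=
  IsLeast {r : ℕ | 0 < r ∧ Function.Periodic g r} p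

/-!
Two squares attack each other exactly when they lie on a common line of direction `(c, d)`, so a
nonattacking placement is a partial transversal of the chains cut out of the board by these lines,
and `u(q; n)` is the `q`-th elementary symmetric function of the chain sizes `L_b`. Through
`∏ (1 + L_b t) = exp (∑ (-1)^i p_{i+1} t^{i+1} / (i + 1))` it is determined by the power sums `p_k`
of the chain sizes.

Counting the squares `z` of the board with `z + j (c, d)` on the board in two ways gives
`∑ (L_b - j)⁺ = (n - j c)⁺ (n - j d)⁺`. Hence, by Abel summation, `p_k` agrees on each residue class
of `n` modulo `d` with a polynomial of degree at most `k + 1`. Passing from the class of `0` to the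
class of `r` does not change `p_1 = n ^ 2`, and it changes `p_k` only in degrees at most `k - 1`.
Since the exponential turns sums into products, comparing degrees shows that the first coefficient
of `u(q; n)` to change is that of `n ^ (2 q - 3)`, and that only the linear coefficient
`r (d - r) (d - c) / d ^ 2` of the change in `p_2` contributes to it, through `-p_2 / 2` and the
leading coefficient `1 / (q - 2)!` of `u(q - 2; n)`.
-/

section ExponentialFormula

open PowerSeries
open Finset.HasAntidiagonal (antidiagonal)

lemma eq_of_derivative_eq_mul {A : Type*} [CommRing A] [IsAddTorsionFree A] {f g s : A⟦X⟧}
    (hf : d⁄dX A f = f * s) (hg : d⁄dX A g = g * s)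
    (h0 : constantCoeff f = constantCoeff g) : f = g := by
  ext n
  induction n using Nat.strong_induction_on with
  | _ n ih =>
    rcases n with _ | n
    · simpa only [coeff_zero_eq_constantCoeff] using h0
    · have hcoeff : coeff (n + 1) f * ((n : A) + 1) = coeff (n + 1) g * ((n : A) + 1) := by
        rw [← coeff_derivative, ← coeff_derivative, hf, hg, coeff_mul, coeff_mul]
        refine Finset.sum_congr rfl fun ij hij => ?_
        rw [ih ij.1 (Nat.lt_succ_of_le (antidiagonal.fst_le hij))]
      refine nsmul_right_injective n.succ_ne_zero ?_
      simpa only [nsmul_eq_mul, Nat.cast_succ, mul_comm _ ((n : A) + 1)] using hcoeff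

variable {A : Type*} [CommRing A] [Algebra ℚ A]

/-- The logarithm `p 0 * X - p 1 * X ^ 2 / 2 + p 2 * X ^ 3 / 3 - ⋯` of the generating function of
the elementary symmetric functions whose power sums are given by `p`. Here `p i` is the power sum
of exponent `i + 1`. -/
noncomputable def logPsumSeries (p : ℕ → A) : A⟦X⟧ :=
  X * mk fun i => ((-1) ^ i / (i + 1) : ℚ) • p i

/-- The generating function of the elementary symmetric functions, written in terms of the power
sums: `p i` stands for the power sum of exponent `i + 1`. -/
noncomputable def esymmSeries (p : ℕ → A) : A⟦X⟧ :=
  (exp A).subst (logPsumSeries p)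

lemma constantCoeff_logPsumSeries (p : ℕ → A) : constantCoeff (logPsumSeries p) = 0 := by
  simp [logPsumSeries]

lemma hasSubst_logPsumSeries (p : ℕ → A) : HasSubst (logPsumSeries p) :=
  HasSubst.of_constantCoeff_zero' (constantCoeff_logPsumSeries p)

lemma derivative_logPsumSeries (p : ℕ → A) :
    d⁄dX A (logPsumSeries p) = mk fun i => (-1) ^ i * p i := by
  ext i
  have hi : ((-1) ^ i / (i + 1) : ℚ) * (i + 1) = (-1) ^ i := by field_simp
  calc coeff i (d⁄dX A (logPsumSeries p))
      = ((-1) ^ i / (i + 1) : ℚ) • p i * ((i : A) + 1) := by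
        rw [coeff_derivative, logPsumSeries, coeff_succ_X_mul, coeff_mk]
    _ = (((-1) ^ i / (i + 1) : ℚ) * (i + 1)) • p i := by
        rw [Algebra.smul_def, Algebra.smul_def, map_mul, map_add, map_natCast, map_one]
        ring
    _ = coeff i (mk fun i => (-1) ^ i * p i) := by
        rw [hi, coeff_mk, Algebra.smul_def, map_pow, map_neg, map_one]

lemma constantCoeff_esymmSeries (p : ℕ → A) : constantCoeff (esymmSeries p) = 1 := by
  have hsub : constantCoeff ((exp A - 1).subst (logPsumSeries p)) = 0 :=
    constantCoeff_subst_eq_zero (constantCoeff_logPsumSeries p) _ (by simp)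
  have hone : (1 : A⟦X⟧).subst (logPsumSeries p) = (1 : A⟦X⟧) := by
    rw [← coe_substAlgHom (hasSubst_logPsumSeries p), map_one]
  rw [subst_sub (hasSubst_logPsumSeries p), hone, map_sub, map_one, sub_eq_zero] at hsub
  exact hsub

lemma derivative_esymmSeries (p : ℕ → A) :
    d⁄dX A (esymmSeries p) = esymmSeries p * mk fun i => (-1) ^ i * p i := by
  rw [esymmSeries, derivative_subst (hasSubst_logPsumSeries p), derivative_exp,
    derivative_logPsumSeries]

lemma eq_esymmSeries {p : ℕ → A} {f : A⟦X⟧} (h0 : constantCoeff f = 1)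
    (hf : d⁄dX A f = f * mk fun i => (-1) ^ i * p i) : f = esymmSeries p :=
  have : IsAddTorsionFree A := .of_module_rat A
  eq_of_derivative_eq_mul hf (derivative_esymmSeries p)
    (h0.trans (constantCoeff_esymmSeries p).symm)

lemma coeff_succ_esymmSeries (p : ℕ → A) (q : ℕ) :
    coeff (q + 1) (esymmSeries p) = (1 / (q + 1) : ℚ) •
      ∑ ij ∈ antidiagonal q, (-1) ^ ij.1 * p ij.1 * coeff ij.2 (esymmSeries p) := by
  have h := congrArg (coeff q) (derivative_esymmSeries p)
  rw [coeff_derivative, mul_comm (esymmSeries p), coeff_mul] at h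
  simp only [coeff_mk] at h
  have hq : (1 / (q + 1) : ℚ) * (q + 1) = 1 := by field_simp
  calc coeff (q + 1) (esymmSeries p)
      = ((1 / (q + 1) : ℚ) * (q + 1)) • coeff (q + 1) (esymmSeries p) := by rw [hq, one_smul]
    _ = (1 / (q + 1) : ℚ) • (coeff (q + 1) (esymmSeries p) * ((q : A) + 1)) := by
        simp only [Algebra.smul_def, map_mul, map_add, map_natCast, map_one]
        ring
    _ = _ := by rw [h]

lemma coeff_one_esymmSeries (p : ℕ → A) : coeff 1 (esymmSeries p) = p 0 := by
  simpa [constantCoeff_esymmSeries] using coeff_succ_esymmSeries p 0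

lemma coeff_two_esymmSeries (p : ℕ → A) :
    coeff 2 (esymmSeries p) = (1 / 2 : ℚ) • (p 0 ^ 2 - p 1) := by
  have h := coeff_succ_esymmSeries p 1
  norm_num [Finset.Nat.antidiagonal_succ, coeff_one_esymmSeries, constantCoeff_esymmSeries] at h
  rw [h, sq, sub_eq_add_neg, smul_add, smul_neg]

lemma esymmSeries_add (p p' : ℕ → A) :
    esymmSeries (p + p') = esymmSeries p * esymmSeries p' := by
  refine (eq_esymmSeries ?_ ?_).symm
  · rw [map_mul, constantCoeff_esymmSeries, constantCoeff_esymmSeries, one_mul]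
  · have hadd : (mk fun i => (-1) ^ i * (p + p') i) =
        (mk fun i => (-1) ^ i * p i) + mk fun i => (-1) ^ i * p' i := by
      ext i
      simp only [map_add, coeff_mk, Pi.add_apply, mul_add]
    rw [Derivation.leibniz, derivative_esymmSeries, derivative_esymmSeries, hadd, smul_eq_mul,
      smul_eq_mul]
    ring

lemma esymmSeries_zero : esymmSeries (0 : ℕ → A) = 1 := by
  refine (eq_esymmSeries (map_one _) ?_).symm
  ext i
  simp

lemma esymmSeries_sum {β : Type*} (s : Finset β) (p : β → ℕ → A) :
    esymmSeries (∑ b ∈ s, p b) = ∏ b ∈ s, esymmSeries (p b) := by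
  classical
  induction s using Finset.induction_on with
  | empty => rw [Finset.sum_empty, Finset.prod_empty, esymmSeries_zero]
  | insert b s hb ih => rw [Finset.sum_insert hb, Finset.prod_insert hb, esymmSeries_add, ih]

lemma esymmSeries_pow_succ (l : A) : esymmSeries (fun i => l ^ (i + 1)) = 1 + C l * X := by
  refine (eq_esymmSeries (by simp) ?_).symm
  ext i
  rcases i with _ | i
  · simp [add_mul, mul_assoc]
  · simp [add_mul, mul_assoc, coeff_succ_X_mul]
    ring

lemma coeff_esymmSeries_sum_pow_succ {β : Type*} (s : Finset β) (l : β → A) (q : ℕ) :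
    coeff q (esymmSeries fun i => ∑ b ∈ s, l b ^ (i + 1)) =
      ∑ T ∈ s.powersetCard q, ∏ b ∈ T, l b := by
  have hsum : (fun i => ∑ b ∈ s, l b ^ (i + 1)) = ∑ b ∈ s, fun i => l b ^ (i + 1) := by
    ext i
    rw [Finset.sum_apply]
  simp only [hsum, esymmSeries_sum, esymmSeries_pow_succ, Finset.prod_one_add,
    Finset.prod_mul_distrib, Finset.prod_const, ← map_prod, map_sum, coeff_C_mul, coeff_X_pow,
    mul_ite, mul_one, mul_zero, eq_comm (a := q)]
  rw [← Finset.sum_filter, Finset.powersetCard_eq_filter]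

lemma map_esymmSeries {B : Type*} [CommRing B] [Algebra ℚ B] (f : A →+* B) (p : ℕ → A) :
    map f (esymmSeries p) = esymmSeries fun i => f (p i) := by
  refine eq_esymmSeries ?_ ?_
  · rw [← coeff_zero_eq_constantCoeff_apply, coeff_map, coeff_zero_eq_constantCoeff_apply,
      constantCoeff_esymmSeries, map_one]
  · have h := congrArg (map f) (derivative_esymmSeries p)
    rw [map_mul] at h
    convert h using 1
    · ext i
      simp [coeff_derivative]
    · congr 1
      ext i
      simp

end ExponentialFormula

section PolynomialDegrees

open Polynomial
open Finset.HasAntidiagonal (antidiagonal)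

lemma natDegree_neg_one_pow_mul {R : Type*} [Ring R] (i : ℕ) (p : R[X]) :
    ((-1) ^ i * p).natDegree = p.natDegree := by
  rcases neg_one_pow_eq_or R[X] i with h | h <;> simp [h]

variable {A : Type*} [CommRing A] [Algebra ℚ A]

lemma natDegree_coeff_esymmSeries_le {p : ℕ → A[X]} {a w : ℕ → ℕ}
    (hp : ∀ i, (p i).natDegree ≤ a i) (haw : ∀ i j, a i + w j ≤ w (i + j + 1)) (q : ℕ) :
    (PowerSeries.coeff q (esymmSeries p)).natDegree ≤ w q := by
  induction q using Nat.strong_induction_on with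
  | _ q ih =>
    rcases q with _ | q
    · simp [constantCoeff_esymmSeries]
    · rw [coeff_succ_esymmSeries]
      refine (natDegree_smul_le _ _).trans (natDegree_sum_le_of_forall_le _ _ fun ij hij => ?_)
      obtain rfl : ij.1 + ij.2 = q := Finset.HasAntidiagonal.mem_antidiagonal.1 hij
      refine natDegree_mul_le.trans ((add_le_add ?_ (ih _ (by lia))).trans (haw _ _))
      exact (natDegree_neg_one_pow_mul _ _).trans_le (hp _)

lemma natDegree_coeff_esymmSeries_le_two_mul {p : ℕ → A[X]}
    (hp : ∀ i, (p i).natDegree ≤ i + 2) (q : ℕ) :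
    (PowerSeries.coeff q (esymmSeries p)).natDegree ≤ 2 * q :=
  natDegree_coeff_esymmSeries_le hp (w := fun q => 2 * q) (fun _ _ => by lia) q

lemma coeff_two_mul_esymmSeries {p : ℕ → A[X]} (hp : ∀ i, (p i).natDegree ≤ i + 2)
    (hp0 : (p 0).coeff 2 = 1) (q : ℕ) :
    (PowerSeries.coeff q (esymmSeries p)).coeff (2 * q) = algebraMap ℚ A (1 / q.factorial) := by
  induction q with
  | zero => simp [constantCoeff_esymmSeries]
  | succ q ih =>
    have hvanish : ∀ ij ∈ antidiagonal q, ij ≠ (0, q) →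
        ((-1) ^ ij.1 * p ij.1 * PowerSeries.coeff ij.2 (esymmSeries p)).coeff (2 * (q + 1)) =
          0 := by
      intro ij hij hne
      have hsum : ij.1 + ij.2 = q := Finset.HasAntidiagonal.mem_antidiagonal.1 hij
      have hpos : ij.1 ≠ 0 := fun h => hne (Prod.ext h (by lia))
      refine coeff_eq_zero_of_natDegree_lt (lt_of_le_of_lt natDegree_mul_le ?_)
      have hfst := (natDegree_neg_one_pow_mul ij.1 (p ij.1)).trans_le (hp _)
      have hsnd := natDegree_coeff_esymmSeries_le_two_mul hp ij.2
      lia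
    have hmain : (p 0 * PowerSeries.coeff q (esymmSeries p)).coeff (2 + 2 * q) =
        algebraMap ℚ A (1 / q.factorial) := by
      rw [coeff_mul_add_eq_of_natDegree_le (hp 0) (natDegree_coeff_esymmSeries_le_two_mul hp q),
        hp0, ih, one_mul]
    rw [coeff_succ_esymmSeries, coeff_smul, finsetSum_coeff,
      Finset.sum_eq_single (0, q) hvanish (by simp), pow_zero, one_mul, mul_add_one,
      add_comm (2 * q), hmain, Nat.factorial_succ, Algebra.smul_def,
      ← map_mul]
    congr 1
    push_cast
    field_simp

lemma coeff_esymmSeries_add {p δ : ℕ → A[X]} (hp : ∀ i, (p i).natDegree ≤ i + 2)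
    (hp0 : (p 0).coeff 2 = 1) (hδ0 : δ 0 = 0) (hδ : ∀ i, (δ i).natDegree ≤ i) (q : ℕ) :
    (PowerSeries.coeff (q + 2) (esymmSeries (p + δ))).coeff (2 * q + 1) =
      (PowerSeries.coeff (q + 2) (esymmSeries p)).coeff (2 * q + 1) -
        algebraMap ℚ A (1 / (2 * q.factorial)) * (δ 1).coeff 1 := by
  set E := fun i => PowerSeries.coeff i (esymmSeries p)
  set H := fun i => PowerSeries.coeff i (esymmSeries δ) with hH
  have hEdeg : ∀ i, (E i).natDegree ≤ 2 * i := natDegree_coeff_esymmSeries_le_two_mul hp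
  have hHdeg : ∀ i, (H i).natDegree ≤ i - 1 :=
    natDegree_coeff_esymmSeries_le hδ (w := fun i => i - 1) fun _ _ => by lia
  have hH0 : H 0 = 1 := by simp [hH, constantCoeff_esymmSeries]
  have hH1 : H 1 = 0 := (coeff_one_esymmSeries δ).trans hδ0
  have hH2 : (H 2).coeff 1 = -((1 / 2 : ℚ) • (δ 1).coeff 1) := by
    simp [hH, coeff_two_esymmSeries, hδ0]
  have htail : ∀ ij ∈ antidiagonal q, ij ≠ (0, q) →
      (H (ij.1 + 1 + 1) * E ij.2).coeff (2 * q + 1) = 0 := by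
    intro ij hij hne
    have hsum : ij.1 + ij.2 = q := Finset.HasAntidiagonal.mem_antidiagonal.1 hij
    have hpos : ij.1 ≠ 0 := fun h => hne (Prod.ext h (by lia))
    refine coeff_eq_zero_of_natDegree_lt (lt_of_le_of_lt natDegree_mul_le ?_)
    have hfst := hHdeg (ij.1 + 1 + 1)
    have hsnd := hEdeg ij.2
    lia
  have hmain : (H 2 * E q).coeff (2 * q + 1) =
      -(algebraMap ℚ A (1 / (2 * q.factorial)) * (δ 1).coeff 1) := by
    rw [add_comm, coeff_mul_add_eq_of_natDegree_le (hHdeg 2) (hEdeg q), hH2,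
      coeff_two_mul_esymmSeries hp hp0, Algebra.smul_def, ← one_div_mul_one_div,
      map_mul]
    ring
  have hexpand : PowerSeries.coeff (q + 2) (esymmSeries (p + δ)) =
      E (q + 2) + ∑ ij ∈ antidiagonal q, H (ij.1 + 1 + 1) * E ij.2 := by
    rw [add_comm p, esymmSeries_add, PowerSeries.coeff_mul, Finset.Nat.sum_antidiagonal_succ,
      Finset.Nat.sum_antidiagonal_succ]
    change H 0 * E (q + 2) + (H 1 * E (q + 1) + _) = _
    rw [hH0, hH1, one_mul, zero_mul, zero_add]
  rw [hexpand, coeff_add, finsetSum_coeff, Finset.sum_eq_single (0, q) htail (by simp), hmain,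
    sub_eq_add_neg]

end PolynomialDegrees

section ChainPowerSumPolynomials

open Polynomial

lemma coeff_taylor_of_natDegree_le_succ {R : Type*} [CommSemiring R] {p : R[X]} {n : ℕ}
    (hp : p.natDegree ≤ n + 1) (s : R) :
    (taylor s p).coeff n = p.coeff n + (n + 1) * p.coeff (n + 1) * s := by
  have hdeg : (hasseDeriv n p).natDegree < 2 :=
    (natDegree_hasseDeriv_le p n).trans_lt (by lia)
  rw [taylor_coeff, eval_eq_sum_range' hdeg]
  simp [Finset.sum_range_succ, hasseDeriv_coeff, add_comm 1 n]

lemma coeff_taylor_of_natDegree_le {R : Type*} [CommSemiring R] {p : R[X]} {n : ℕ}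
    (hp : p.natDegree ≤ n) (s : R) : (taylor s p).coeff n = p.coeff n := by
  have := coeff_taylor_of_natDegree_le_succ (hp.trans n.le_succ) s
  rwa [coeff_eq_zero_of_natDegree_lt (Nat.lt_succ_of_le hp), mul_zero, zero_mul, add_zero] at this

/-- The polynomial whose value at `m` is `0 ^ k + 1 ^ k + ⋯ + (m - 1) ^ k`. -/
noncomputable def rangePowSum (k : ℕ) : ℚ[X] :=
  C (1 / (k + 1 : ℚ)) * (Polynomial.bernoulli (k + 1) - C (_root_.bernoulli (k + 1)))

lemma eval_rangePowSum (k m : ℕ) :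
    (rangePowSum k).eval (m : ℚ) = ∑ j ∈ Finset.range m, (j : ℚ) ^ k := by
  rw [rangePowSum, eval_mul, eval_sub, eval_C, eval_C, ← Nat.succ_eq_add_one,
    ← sum_range_pow_eq_bernoulli_sub]
  field_simp

lemma natDegree_rangePowSum_le (k : ℕ) : (rangePowSum k).natDegree ≤ k + 1 := by
  refine (natDegree_C_mul_le _ _).trans ((natDegree_sub_C).trans_le ?_)
  exact natDegree_le_iff_coeff_eq_zero.2 fun N hN => by rw [coeff_bernoulli, if_neg hN.not_ge]

lemma coeff_succ_rangePowSum (k : ℕ) : (rangePowSum k).coeff (k + 1) = 1 / (k + 1 : ℚ) := by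
  simp [rangePowSum, coeff_bernoulli]

lemma rangePowSum_one : rangePowSum 1 = C (1 / 2) * X ^ 2 - C (1 / 2) * X := by
  ext n
  rcases n with _ | _ | _ | n <;> norm_num [rangePowSum, coeff_bernoulli, coeff_X, coeff_X_pow]

lemma rangePowSum_two :
    rangePowSum 2 = C (1 / 3) * X ^ 3 - C (1 / 2) * X ^ 2 + C (1 / 6) * X := by
  ext n
  rcases n with _ | _ | _ | _ | n <;>
    norm_num [rangePowSum, coeff_bernoulli, coeff_X, coeff_X_pow, Nat.choose]

/-- The power sum of exponent `i + 1` of the chain sizes on the board of size `d * m + r`, as a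
polynomial in `m`. The first two terms come from Abel summation over the levels `j < m`, the last
one from the top level `j = m`. -/
noncomputable def chainPsumQuotient (c d r : ℚ) (i : ℕ) : ℚ[X] :=
  C (2 * c * d) * rangePowSum (i + 1) +
    X ^ (i + 1) * (C (d * (d - c)) * X + C (r * (c + d) + c * d)) +
      ((X + 1) ^ (i + 1) - X ^ (i + 1)) * (C (r * (d - c)) * X + C (r ^ 2))

lemma natDegree_chainPsumQuotient_le (c d r : ℚ) (i : ℕ) :
    (chainPsumQuotient c d r i).natDegree ≤ i + 2 := by
  have hpow : ((X + 1 : ℚ[X]) ^ (i + 1)).natDegree ≤ i + 1 := by compute_degree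
  have hpow' : (X ^ (i + 1) : ℚ[X]).natDegree ≤ i + 1 := natDegree_X_pow_le _
  refine natDegree_add_le_of_degree_le (natDegree_add_le_of_degree_le ?_ ?_) ?_
  · exact (natDegree_C_mul_le _ _).trans (natDegree_rangePowSum_le _)
  · exact natDegree_mul_le_of_le (n := 1) hpow' natDegree_linear_le
  · exact natDegree_mul_le_of_le (n := 1) ((natDegree_sub_le_of_le hpow hpow').trans
      (max_self _).le) natDegree_linear_le

lemma coeff_add_two_chainPsumQuotient (c d r : ℚ) (i : ℕ) :
    (chainPsumQuotient c d r i).coeff (i + 2) = 2 * c * d / (i + 2) + d * (d - c) := by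
  have hF := coeff_succ_rangePowSum (i + 1)
  simp only [chainPsumQuotient, coeff_add, mul_add, ← mul_assoc, coeff_mul_C, coeff_C_mul,
    coeff_mul_X, coeff_sub, coeff_X_pow, coeff_X_add_one_pow, hF, mul_right_comm _ (C _) X]
  simp
  ring

lemma coeff_add_one_chainPsumQuotient (c d r : ℚ) (i : ℕ) :
    (chainPsumQuotient c d r i).coeff (i + 1) =
      2 * c * d * (rangePowSum (i + 1)).coeff (i + 1) + (r * (c + d) + c * d) +
        (i + 1) * (r * (d - c)) := by
  simp only [chainPsumQuotient, coeff_add, mul_add, ← mul_assoc, coeff_mul_C, coeff_C_mul,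
    coeff_mul_X, coeff_sub, coeff_X_pow, coeff_X_add_one_pow, mul_right_comm _ (C _) X]
  simp

lemma chainPsumQuotient_zero (c d r : ℚ) :
    chainPsumQuotient c d r 0 = (C d * X + C r) ^ 2 := by
  refine funext fun x => ?_
  simp [chainPsumQuotient, rangePowSum_one]
  ring

lemma chainPsumQuotient_one (c d r : ℚ) :
    chainPsumQuotient c d r 1 = C (d ^ 2 - c * d / 3) * X ^ 3 + C (r * (3 * d - c)) * X ^ 2 +
      C (c * d / 3 + r * (d - c) + 2 * r ^ 2) * X + C (r ^ 2) := by
  refine funext fun x => ?_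
  simp [chainPsumQuotient, rangePowSum_two]
  ring

lemma natDegree_chainPsumQuotient_sub_taylor_le {d : ℚ} (hd : d ≠ 0) (c r : ℚ) (i : ℕ) :
    (chainPsumQuotient c d r i - taylor (r / d) (chainPsumQuotient c d 0 i)).natDegree ≤ i := by
  refine natDegree_le_iff_coeff_eq_zero.2 fun N hN => ?_
  have hle := natDegree_chainPsumQuotient_le c d
  obtain rfl | rfl | hN : N = i + 1 ∨ N = i + 2 ∨ i + 2 < N := by lia
  · rw [coeff_sub, coeff_taylor_of_natDegree_le_succ (hle 0 i), coeff_add_one_chainPsumQuotient,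
      coeff_add_one_chainPsumQuotient, coeff_add_two_chainPsumQuotient]
    push_cast
    field_simp
    ring
  · rw [coeff_sub, coeff_taylor_of_natDegree_le (hle 0 i), coeff_add_two_chainPsumQuotient,
      coeff_add_two_chainPsumQuotient, sub_self]
  · refine coeff_eq_zero_of_natDegree_lt (lt_of_le_of_lt ?_ hN)
    exact (natDegree_sub_le_of_le (hle r i) ((natDegree_taylor _ _).trans_le (hle 0 i))).trans
      (max_self _).le

lemma coeff_one_chainPsumQuotient_sub_taylor {d : ℚ} (hd : d ≠ 0) (c r : ℚ) :
    (chainPsumQuotient c d r 1 - taylor (r / d) (chainPsumQuotient c d 0 1)).coeff 1 =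
      r * (d - r) * (d - c) / d := by
  rw [coeff_sub, taylor_coeff_one, chainPsumQuotient_one, chainPsumQuotient_one]
  simp only [coeff_add, coeff_C_mul, coeff_X_pow, coeff_X, coeff_C, derivative_add,
    derivative_C_mul, derivative_X_pow, derivative_X, derivative_C, eval_add, eval_mul, eval_pow,
    eval_C, eval_X]
  norm_num
  field_simp
  ring

/-- The power sum of exponent `i + 1` of the chain sizes on boards whose size is `r` modulo `d`,
as a polynomial in the size. -/
noncomputable def chainPsum (c d r : ℚ) (i : ℕ) : ℚ[X] :=
  (taylor (-(r / d)) (chainPsumQuotient c d r i)).comp (C (1 / d) * X)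

lemma eval_chainPsum {d : ℚ} (hd : d ≠ 0) (c r m : ℚ) (i : ℕ) :
    (chainPsum c d r i).eval (d * m + r) = (chainPsumQuotient c d r i).eval m := by
  have harg : 1 / d * (d * m + r) - r / d = m := by field_simp; ring
  rw [chainPsum, eval_comp, taylor_eval, eval_mul, eval_C, eval_X, ← sub_eq_add_neg, harg]

lemma natDegree_comp_C_mul_X_le {R : Type*} [CommSemiring R] (p : R[X]) (a : R) :
    (p.comp (C a * X)).natDegree ≤ p.natDegree :=
  natDegree_le_iff_coeff_eq_zero.2 fun N hN => by
    rw [comp_C_mul_X_coeff, coeff_eq_zero_of_natDegree_lt hN, zero_mul]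

lemma natDegree_chainPsum_le (c d r : ℚ) (i : ℕ) : (chainPsum c d r i).natDegree ≤ i + 2 :=
  (natDegree_comp_C_mul_X_le _ _).trans
    ((natDegree_taylor _ _).trans_le (natDegree_chainPsumQuotient_le c d r i))

lemma chainPsum_zero {d : ℚ} (hd : d ≠ 0) (c r : ℚ) : chainPsum c d r 0 = X ^ 2 := by
  refine funext fun x => ?_
  simp [chainPsum, chainPsumQuotient_zero]
  field_simp
  ring

lemma chainPsum_sub (c d r : ℚ) (i : ℕ) :
    chainPsum c d r i - chainPsum c d 0 i =
      (taylor (-(r / d)) (chainPsumQuotient c d r i -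
        taylor (r / d) (chainPsumQuotient c d 0 i))).comp (C (1 / d) * X) := by
  rw [map_sub, taylor_taylor, neg_add_cancel, sub_comp, chainPsum, chainPsum, zero_div, neg_zero]

lemma natDegree_chainPsum_sub_le {d : ℚ} (hd : d ≠ 0) (c r : ℚ) (i : ℕ) :
    (chainPsum c d r i - chainPsum c d 0 i).natDegree ≤ i := by
  rw [chainPsum_sub]
  exact (natDegree_comp_C_mul_X_le _ _).trans
    ((natDegree_taylor _ _).trans_le (natDegree_chainPsumQuotient_sub_taylor_le hd c r i))

lemma coeff_one_chainPsum_sub {d : ℚ} (hd : d ≠ 0) (c r : ℚ) :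
    (chainPsum c d r 1 - chainPsum c d 0 1).coeff 1 = r * (d - r) * (d - c) / d ^ 2 := by
  rw [chainPsum_sub, comp_C_mul_X_coeff,
    coeff_taylor_of_natDegree_le (natDegree_chainPsumQuotient_sub_taylor_le hd c r 1),
    coeff_one_chainPsumQuotient_sub_taylor hd]
  field_simp

end ChainPowerSumPolynomials

section Transversals

variable {α β : Type*} [DecidableEq β] (f : α → β) (B : Finset α)
  [DecidablePred fun S : Finset α => Set.InjOn f S]

lemma card_filter_injOn_image_eq (T : Finset β) :
    ((B.powersetCard T.card).filter
        fun S : Finset α => Set.InjOn f S ∧ S.image f = T).card =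
      ∏ b ∈ T, (B.filter fun a => f a = b).card := by
  classical
  have hsec : ∀ g : T → α, g ∈ Fintype.piFinset (fun b : T => B.filter fun a => f a = b) ↔
      (∀ b, g b ∈ B) ∧ f ∘ g = Subtype.val := fun g => by
    simp only [Fintype.mem_piFinset, Finset.mem_filter, forall_and, funext_iff, Function.comp_apply]
  rw [← Finset.prod_coe_sort T, ← Fintype.card_piFinset]
  refine (Finset.card_bij (fun g _ => Finset.univ.image g) ?_ ?_ ?_).symm
  · intro g hg
    obtain ⟨hgB, hfg⟩ := (hsec g).1 hg
    have hinj : Function.Injective (f ∘ g) := hfg ▸ Subtype.val_injective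
    rw [Finset.mem_filter, Finset.mem_powersetCard]
    refine ⟨⟨Finset.image_subset_iff.2 fun b _ => hgB b, ?_⟩, ?_, ?_⟩
    · rw [Finset.card_image_of_injective _ hinj.of_comp, Finset.card_univ, Fintype.card_coe]
    · rw [Finset.coe_image, Finset.coe_univ, Set.image_univ]
      exact hinj.injOn_range
    · rw [Finset.image_image, hfg, Finset.univ_eq_attach, Finset.attach_image_val]
  · intro g hg g' hg' himage
    funext b
    have hmem : g b ∈ Finset.univ.image g' :=
      himage ▸ Finset.mem_image_of_mem g (Finset.mem_univ b)
    obtain ⟨b', -, hb'⟩ := Finset.mem_image.1 hmem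
    have hbb' : b' = b := Subtype.ext <|
      calc (b' : β) = f (g' b') := (congrFun ((hsec g').1 hg').2 b').symm
        _ = f (g b) := congrArg f hb'
        _ = b := congrFun ((hsec g).1 hg).2 b
    rw [← hb', hbb']
  · intro S hS
    obtain ⟨⟨hSB, -⟩, hinj, rfl⟩ := by
      simpa only [Finset.mem_filter, Finset.mem_powersetCard] using hS
    choose g hgS hfg using fun b : S.image f => Finset.mem_image.1 b.2
    refine ⟨g, (hsec g).2 ⟨fun b => hSB (hgS b), funext hfg⟩, Finset.ext fun a => ?_⟩
    rw [Finset.mem_image]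
    refine ⟨?_, fun ha => ⟨⟨f a, Finset.mem_image_of_mem f ha⟩, Finset.mem_univ _, ?_⟩⟩
    · rintro ⟨b, -, rfl⟩
      exact hgS b
    · exact hinj (hgS _) ha (hfg _)

lemma card_powersetCard_filter_injOn (q : ℕ) :
    ((B.powersetCard q).filter fun S : Finset α => Set.InjOn f S).card =
      ∑ T ∈ (B.image f).powersetCard q, ∏ b ∈ T, (B.filter fun a => f a = b).card := by
  have himage : ∀ S ∈ (B.powersetCard q).filter fun S : Finset α => Set.InjOn f S,
      S.image f ∈ (B.image f).powersetCard q := fun S hS => by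
    obtain ⟨⟨hSB, hcard⟩, hinj⟩ := by
      simpa only [Finset.mem_filter, Finset.mem_powersetCard] using hS
    exact Finset.mem_powersetCard.2
      ⟨Finset.image_subset_image hSB, (Finset.card_image_of_injOn hinj).trans hcard⟩
  rw [Finset.card_eq_sum_card_fiberwise himage]
  refine Finset.sum_congr rfl fun T hT => ?_
  obtain ⟨-, rfl⟩ := Finset.mem_powersetCard.1 hT
  rw [Finset.filter_filter, card_filter_injOn_image_eq]

end Transversals

section Chains

/-- The label of the line in direction `(c, d)` through a point. -/
def lineLabel (c d : ℕ) (z : ℤ × ℤ) : ℤ := d * z.1 - c * z.2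

/-- The part of the board on the line with label `b`. -/
noncomputable def chain (c d n : ℕ) (b : ℤ) : Finset (ℤ × ℤ) :=
  (board n).filter fun z => lineLabel c d z = b

/-- The labels of the lines that meet the board. -/
noncomputable def boardLabels (c d n : ℕ) : Finset ℤ := (board n).image (lineLabel c d)

lemma mem_board {n : ℕ} {z : ℤ × ℤ} :
    z ∈ board n ↔ (1 ≤ z.1 ∧ z.1 ≤ n) ∧ 1 ≤ z.2 ∧ z.2 ≤ n := by
  simp only [board, Finset.mem_product, Finset.mem_Icc]

lemma coe_board (n : ℕ) : (board n : Set (ℤ × ℤ)) = Set.Icc (1, 1) ((n : ℤ), (n : ℤ)) := by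
  rw [board, Finset.coe_product, Finset.coe_Icc, Set.Icc_prod_Icc]

lemma card_filter_add_mem_of_ordConnected {S : Finset ℤ} (hS : (S : Set ℤ).OrdConnected) (j : ℕ) :
    (S.filter fun t => t + (j : ℤ) ∈ S).card = S.card - j := by
  rcases S.eq_empty_or_nonempty with rfl | hne
  · simp
  · have hIcc : S = Finset.Icc (S.min' hne) (S.max' hne) := by
      refine Finset.Subset.antisymm (fun t ht => ?_) fun t ht => ?_
      · exact Finset.mem_Icc.2 ⟨S.min'_le t ht, S.le_max' t ht⟩
      · exact hS.out (S.min'_mem hne) (S.max'_mem hne) (Finset.mem_Icc.1 ht)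
    generalize S.min' hne = a at hIcc
    generalize S.max' hne = b at hIcc
    subst hIcc
    have hfilter : (Finset.Icc a b).filter (fun t => t + (j : ℤ) ∈ Finset.Icc a b) =
        Finset.Icc a (b - j) := by
      ext t
      simp only [Finset.mem_filter, Finset.mem_Icc]
      lia
    rw [hfilter, Int.card_Icc, Int.card_Icc]
    lia

lemma card_board_filter_add_mem (c d n j : ℕ) :
    ((board n).filter fun z => z + (j : ℤ) • ((c : ℤ), (d : ℤ)) ∈ board n).card =
      (n - j * c) * (n - j * d) := by
  have hshift : ((board n).filter fun z => z + (j : ℤ) • ((c : ℤ), (d : ℤ)) ∈ board n) =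
      Finset.Icc (1 : ℤ) (n - j * c) ×ˢ Finset.Icc (1 : ℤ) (n - j * d) := by
    ext z
    have : (0 : ℤ) ≤ j * c := by positivity
    have : (0 : ℤ) ≤ j * d := by positivity
    simp only [Finset.mem_filter, mem_board, Finset.mem_product, Finset.mem_Icc, Prod.fst_add,
      Prod.snd_add, Prod.smul_mk, smul_eq_mul]
    constructor <;> intro h <;> refine ⟨⟨?_, ?_⟩, ?_, ?_⟩ <;> lia
  have hcard : ∀ e : ℕ, (Finset.Icc (1 : ℤ) (n - j * e)).card = n - j * e := fun e => by
    rw [Int.card_Icc, ← Nat.cast_mul]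
    lia
  rw [hshift, Finset.card_product, hcard, hcard]

variable {c d : ℕ} (hcop : Nat.Coprime c d) (hd : 0 < d)
include hcop hd

lemma attacks_iff_lineLabel_eq (z w : ℤ × ℤ) :
    Attacks {((c : ℤ), (d : ℤ))} z w ↔ lineLabel c d z = lineLabel c d w := by
  obtain ⟨x, y⟩ := z
  obtain ⟨x', y'⟩ := w
  simp only [Attacks, Set.mem_singleton_iff, exists_eq_left, lineLabel, Prod.mk_sub_mk,
    Prod.smul_mk, Prod.mk.injEq, smul_eq_mul]
  constructor
  · rintro ⟨k, hx, hy⟩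
    linear_combination (-(d : ℤ)) * hx + (c : ℤ) * hy
  · intro h
    have hlabel : (d : ℤ) * (x' - x) = c * (y' - y) := by linear_combination -h
    obtain ⟨k, hk⟩ : (d : ℤ) ∣ y' - y :=
      (Nat.isCoprime_iff_coprime.2 hcop.symm).dvd_of_dvd_mul_left ⟨x' - x, hlabel.symm⟩
    have hd₀ : (d : ℤ) ≠ 0 := by exact_mod_cast hd.ne'
    refine ⟨k, mul_left_cancel₀ hd₀ ?_, by rw [hk, mul_comm]⟩
    rw [hlabel, hk]
    ring

lemma nonattacking_iff_injOn_lineLabel (S : Finset (ℤ × ℤ)) :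
    Nonattacking {((c : ℤ), (d : ℤ))} S ↔ Set.InjOn (lineLabel c d) S := by
  simp only [Nonattacking, attacks_iff_lineLabel_eq hcop hd]
  exact forall₄_congr fun z _ w _ => not_imp_not

lemma numNonattacking_eq_sum_prod_card_chain (q n : ℕ) :
    numNonattacking {((c : ℤ), (d : ℤ))} q n =
      ∑ T ∈ (boardLabels c d n).powersetCard q, ∏ b ∈ T, (chain c d n b).card := by
  classical
  unfold chain boardLabels
  rw [← card_powersetCard_filter_injOn, numNonattacking]
  refine congrArg Finset.card (Finset.ext fun S => ?_)
  simp only [Finset.mem_filter, nonattacking_iff_injOn_lineLabel hcop hd]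

lemma card_chain_filter_add_mem (n j : ℕ) (z : ℤ × ℤ) :
    ((chain c d n (lineLabel c d z)).filter
        fun w => w + (j : ℤ) • ((c : ℤ), (d : ℤ)) ∈ board n).card =
      (chain c d n (lineLabel c d z)).card - j := by
  set φ : ℤ → ℤ × ℤ := fun t => z + t • ((c : ℤ), (d : ℤ)) with hφ
  have hinj : Function.Injective φ := fun s t hst => by
    have hsnd : s * (d : ℤ) = t * d := by simpa [hφ] using congrArg Prod.snd hst
    exact mul_right_cancel₀ (by exact_mod_cast hd.ne') hsnd
  have hmove : (0 : ℤ × ℤ) ≤ ((c : ℤ), (d : ℤ)) := ⟨c.cast_nonneg, d.cast_nonneg⟩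
  have hmono : Monotone φ := fun s t hst =>
    add_le_add_right (smul_le_smul_of_nonneg_right hst hmove) z
  set T := (board n).preimage φ hinj.injOn with hT
  have hchain : chain c d n (lineLabel c d z) = T.image φ := by
    ext w
    simp only [chain, Finset.mem_filter, Finset.mem_image, hT, Finset.mem_preimage]
    rw [eq_comm, ← attacks_iff_lineLabel_eq hcop hd]
    simp only [Attacks, Set.mem_singleton_iff, exists_eq_left, sub_eq_iff_eq_add']
    constructor
    · rintro ⟨hw, t, rfl⟩
      exact ⟨t, hw, rfl⟩
    · rintro ⟨t, hw, rfl⟩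
      exact ⟨hw, t, rfl⟩
  have hord : (T : Set ℤ).OrdConnected := by
    rw [hT, Finset.coe_preimage, coe_board]
    exact Set.ordConnected_Icc.preimage_mono hmono
  have hshift : ∀ t, φ t + (j : ℤ) • ((c : ℤ), (d : ℤ)) ∈ board n ↔ t + (j : ℤ) ∈ T := fun t => by
    rw [hT, Finset.mem_preimage]
    simp only [hφ, add_smul, add_assoc]
  rw [hchain, Finset.filter_image, Finset.card_image_of_injective _ hinj,
    Finset.card_image_of_injective _ hinj, ← card_filter_add_mem_of_ordConnected hord]
  simp only [hshift]

lemma sum_card_chain_sub (n j : ℕ) :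
    ∑ b ∈ boardLabels c d n, ((chain c d n b).card - j) = (n - j * c) * (n - j * d) := by
  have hlabel : ∀ z ∈ (board n).filter fun z => z + (j : ℤ) • ((c : ℤ), (d : ℤ)) ∈ board n,
      lineLabel c d z ∈ boardLabels c d n := fun z hz =>
    Finset.mem_image_of_mem _ (Finset.mem_filter.1 hz).1
  rw [← card_board_filter_add_mem, Finset.card_eq_sum_card_fiberwise hlabel]
  refine Finset.sum_congr rfl fun b hb => ?_
  obtain ⟨z, -, rfl⟩ := Finset.mem_image.1 hb
  rw [← card_chain_filter_add_mem hcop hd, chain, Finset.filter_comm]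

end Chains

section ChainPowerSums

lemma sum_eq_sum_range_sub_mul_sum_tsub {β R : Type*} [CommRing R] {s : Finset β} {l : β → ℕ}
    {M : ℕ} (hl : ∀ b ∈ s, l b ≤ M) {g : ℕ → R} (hg : g 0 = 0) :
    ∑ b ∈ s, g (l b) = ∑ j ∈ Finset.range M, (g (j + 1) - g j) *
      (∑ b ∈ s, ((l b - j : ℕ) : R) - ∑ b ∈ s, ((l b - (j + 1) : ℕ) : R)) := by
  have htsub : ∀ a j : ℕ, ((a - j : ℕ) : R) - ((a - (j + 1) : ℕ) : R) = if j < a then 1 else 0 := by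
    intro a j
    split_ifs with h
    · rw [← Nat.cast_sub (by lia), show a - j - (a - (j + 1)) = 1 by lia, Nat.cast_one]
    · rw [Nat.sub_eq_zero_of_le (by lia), Nat.sub_eq_zero_of_le (by lia), sub_self]
  have htelescope : ∀ a ≤ M, g a = ∑ j ∈ Finset.range M,
      (g (j + 1) - g j) * (((a - j : ℕ) : R) - ((a - (j + 1) : ℕ) : R)) := fun a ha => by
    have hfilter : (Finset.range M).filter (· < a) = Finset.range a := by
      ext j
      simp only [Finset.mem_filter, Finset.mem_range]
      lia
    simp only [htsub, mul_ite, mul_one, mul_zero]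
    rw [← Finset.sum_filter, hfilter, Finset.sum_range_sub, hg, sub_zero]
  rw [Finset.sum_congr rfl fun b hb => htelescope (l b) (hl b hb), Finset.sum_comm]
  simp only [← Finset.mul_sum, Finset.sum_sub_distrib]

lemma sum_range_pow_sub_pow_mul_linear {R : Type*} [CommRing R] {k : ℕ} (hk : k ≠ 0) (m : ℕ)
    (α β : R) :
    ∑ j ∈ Finset.range m, (((j : R) + 1) ^ k - (j : R) ^ k) * (α - (2 * j + 1) * β) =
      (m : R) ^ k * (α - (2 * m - 1) * β) + 2 * β * ∑ j ∈ Finset.range m, (j : R) ^ k := by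
  induction m with
  | zero => simp [hk]
  | succ m ih =>
    rw [Finset.sum_range_succ, ih, Finset.sum_range_succ]
    push_cast
    ring

lemma eval_chainPsumQuotient (c d r : ℚ) (i m : ℕ) :
    (chainPsumQuotient c d r i).eval (m : ℚ) =
      ∑ j ∈ Finset.range m, (((j : ℚ) + 1) ^ (i + 1) - (j : ℚ) ^ (i + 1)) *
          ((d * m + r) * (c + d) - (2 * j + 1) * (c * d)) +
        (((m : ℚ) + 1) ^ (i + 1) - (m : ℚ) ^ (i + 1)) * ((d * m + r - m * c) * r) := by
  rw [sum_range_pow_sub_pow_mul_linear (Nat.add_one_ne_zero i)]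
  simp only [chainPsumQuotient, Polynomial.eval_add, Polynomial.eval_sub, Polynomial.eval_mul,
    Polynomial.eval_pow, Polynomial.eval_C, Polynomial.eval_X, Polynomial.eval_one,
    eval_rangePowSum]
  ring

variable {c d : ℕ} (hcd : c ≤ d) (hcop : Nat.Coprime c d) (hd : 0 < d)
include hcop hd

lemma card_chain_le {n : ℕ} {b : ℤ} (hb : b ∈ boardLabels c d n) :
    (chain c d n b).card ≤ n / d + 1 := by
  have hzero : ∑ b ∈ boardLabels c d n, ((chain c d n b).card - (n / d + 1)) = 0 := by
    have : n ≤ (n / d + 1) * d := by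
      rw [mul_comm]
      exact (Nat.lt_mul_div_succ n hd).le
    rw [sum_card_chain_sub hcop hd, Nat.sub_eq_zero_of_le this, mul_zero]
  exact Nat.sub_eq_zero_iff_le.1 (Finset.sum_eq_zero_iff.1 hzero b hb)

include hcd

lemma sum_cast_card_chain_sub {n j : ℕ} (hj : j ≤ n / d) :
    ∑ b ∈ boardLabels c d n, (((chain c d n b).card - j : ℕ) : ℚ) =
      (n - j * c) * (n - j * d) := by
  have hjd : j * d ≤ n := (Nat.mul_le_mul_right d hj).trans (Nat.div_mul_le_self n d)
  have hjc : j * c ≤ n := (Nat.mul_le_mul_left j hcd).trans hjd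
  rw [← Nat.cast_sum, sum_card_chain_sub hcop hd]
  push_cast [Nat.cast_sub hjd, Nat.cast_sub hjc]
  rfl

lemma eval_chainPsum_eq_sum_card_chain_pow (n i : ℕ) :
    (chainPsum c d (n % d : ℕ) i).eval (n : ℚ) =
      ∑ b ∈ boardLabels c d n, ((chain c d n b).card : ℚ) ^ (i + 1) := by
  have hd₀ : (d : ℚ) ≠ 0 := by exact_mod_cast hd.ne'
  have hn : (n : ℚ) = d * (n / d : ℕ) + (n % d : ℕ) := by exact_mod_cast (Nat.div_add_mod n d).symm
  have hsum := fun j => sum_cast_card_chain_sub hcd hcop hd (n := n) (j := j)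
  have hlast : ∑ b ∈ boardLabels c d n, (((chain c d n b).card - (n / d + 1) : ℕ) : ℚ) = 0 :=
    Finset.sum_eq_zero fun b hb => by
      rw [Nat.sub_eq_zero_of_le (card_chain_le hcop hd hb), Nat.cast_zero]
  rw [sum_eq_sum_range_sub_mul_sum_tsub (fun _ => card_chain_le hcop hd)
    (g := fun a => (a : ℚ) ^ (i + 1)) (by simp), Finset.sum_range_succ, hlast, hsum _ le_rfl,
    sub_zero]
  conv_lhs => rw [hn, eval_chainPsum hd₀, eval_chainPsumQuotient, ← hn]
  congr 1
  · refine Finset.sum_congr rfl fun j hj => ?_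
    rw [hsum j (Finset.mem_range.1 hj).le, hsum (j + 1) (Finset.mem_range.1 hj)]
    push_cast
    ring
  · push_cast
    linear_combination
      -((((n / d : ℕ) : ℚ) + 1) ^ (i + 1) - ((n / d : ℕ) : ℚ) ^ (i + 1)) *
        (n - (n / d : ℕ) * c) * hn

end ChainPowerSums

/-- The number of nonattacking placements of `q` pieces on boards whose size is `r` modulo `d`, as
a polynomial in the size. -/
noncomputable def placementPoly (c d r : ℚ) (q : ℕ) : Polynomial ℚ :=
  PowerSeries.coeff q (esymmSeries (chainPsum c d r))

lemma natDegree_placementPoly_le (c d r : ℚ) (q : ℕ) :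
    (placementPoly c d r q).natDegree ≤ 2 * q :=
  natDegree_coeff_esymmSeries_le_two_mul (natDegree_chainPsum_le c d r) q

lemma eval_placementPoly {c d : ℕ} (hcd : c ≤ d) (hcop : Nat.Coprime c d) (hd : 0 < d) (q n : ℕ) :
    (placementPoly c d (n % d : ℕ) q).eval (n : ℚ) =
      numNonattacking {((c : ℤ), (d : ℤ))} q n := by
  rw [placementPoly, ← Polynomial.coe_evalRingHom, ← PowerSeries.coeff_map, map_esymmSeries]
  simp only [Polynomial.coe_evalRingHom, eval_chainPsum_eq_sum_card_chain_pow hcd hcop hd]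
  rw [coeff_esymmSeries_sum_pow_succ, numNonattacking_eq_sum_prod_card_chain hcop hd]
  push_cast
  rfl

lemma coeff_placementPoly {d : ℚ} (hd : d ≠ 0) (c r : ℚ) (q : ℕ) :
    (placementPoly c d r (q + 2)).coeff (2 * q + 1) =
      (placementPoly c d 0 (q + 2)).coeff (2 * q + 1) -
        1 / (2 * q.factorial) * (r * (d - r) * (d - c) / d ^ 2) := by
  have hadd : chainPsum c d r = chainPsum c d 0 + (chainPsum c d r - chainPsum c d 0) :=
    (add_sub_cancel _ _).symm
  rw [placementPoly, hadd, coeff_esymmSeries_add (natDegree_chainPsum_le c d 0)]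
  · rw [Pi.sub_apply, coeff_one_chainPsum_sub hd, placementPoly, Algebra.algebraMap_self_apply]
  · simp [chainPsum_zero hd]
  · simp [chainPsum_zero hd]
  · exact natDegree_chainPsum_sub_le hd c r

section Quasipolynomials

open Polynomial

lemma exists_common_period {α ι : Type*} {g : ι → ℕ → α} {s : Finset ι}
    (h : ∀ i ∈ s, ∃ p, 0 < p ∧ Function.Periodic (g i) p) :
    ∃ N, 0 < N ∧ ∀ i ∈ s, Function.Periodic (g i) N := by
  choose! p hpos hper using h
  refine ⟨∏ i ∈ s, p i, Finset.prod_pos hpos, fun i hi => ?_⟩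
  obtain ⟨m, hm⟩ := Finset.dvd_prod_of_mem p hi
  rw [hm, mul_comm]
  exact (hper i hi).nat_mul m

lemma eq_of_eval_add_mul_eq {R : Type*} [CommRing R] [IsDomain R] [CharZero R] {p q : R[X]}
    {a N : ℕ} (hN : 0 < N)
    (h : ∀ t : ℕ, p.eval ((a + t * N : ℕ) : R) = q.eval ((a + t * N : ℕ) : R)) : p = q := by
  have hinj : Function.Injective fun t : ℕ => ((a + t * N : ℕ) : R) := fun t t' htt' =>
    Nat.eq_of_mul_eq_mul_right hN (Nat.add_left_cancel (Nat.cast_injective htt'))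
  exact eq_of_infinite_eval_eq p q (Set.infinite_of_injective_forall_mem hinj h)

lemma isQuasipolynomialExpansion_coeff {f : ℕ → ℚ} {D d : ℕ} (hd : 0 < d) {P : ℕ → ℚ[X]}
    (hP : ∀ r, (P r).natDegree ≤ D) (hf : ∀ n : ℕ, f n = (P (n % d)).eval (n : ℚ)) :
    IsQuasipolynomialExpansion f D fun i n => (P (n % d)).coeff (D - i) := by
  refine ⟨fun i _ => ⟨d, hd, fun n => ?_⟩, fun n => ?_⟩
  · simp only [Nat.add_mod_right]
  · rw [hf, eval_eq_sum_range' (Nat.lt_succ_of_le (hP _)), ← Finset.sum_range_reflect]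
    rfl

lemma IsQuasipolynomialExpansion.eq_coeff {f : ℕ → ℚ} {D d : ℕ} {γ : ℕ → ℕ → ℚ}
    (h : IsQuasipolynomialExpansion f D γ) (hd : 0 < d) {P : ℕ → ℚ[X]}
    (hf : ∀ n : ℕ, f n = (P (n % d)).eval (n : ℚ)) {i : ℕ} (hi : i ≤ D) (n : ℕ) :
    γ i n = (P (n % d)).coeff (D - i) := by
  obtain ⟨N, hN, hper⟩ := exists_common_period (s := Finset.range (D + 1)) fun i hi =>
    h.1 i (Finset.mem_range_succ_iff.1 hi)
  have hP : P (n % d) = ∑ j ∈ Finset.range (D + 1), C (γ j n) * X ^ (D - j) := by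
    refine eq_of_eval_add_mul_eq (a := n) (Nat.mul_pos hN hd) fun t => ?_
    have hmod : (n + t * (N * d)) % d = n % d := by
      rw [← mul_assoc, Nat.add_mul_mod_self_right]
    have hγ : ∀ j ∈ Finset.range (D + 1), γ j (n + t * (N * d)) = γ j n := fun j hj => by
      rw [mul_comm N, ← mul_assoc]
      exact (hper j hj).nat_mul (t * d) n
    rw [← hmod, ← hf, h.2, eval_finsetSum]
    refine Finset.sum_congr rfl fun j hj => ?_
    rw [hγ j hj, eval_mul, eval_C, eval_pow, eval_X]
  rw [hP, finsetSum_coeff, Finset.sum_eq_single_of_mem i (Finset.mem_range_succ_iff.2 hi)]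
  · rw [coeff_C_mul, coeff_X_pow_self, mul_one]
  · intro j hj hji
    have := Finset.mem_range_succ_iff.1 hj
    rw [coeff_C_mul, coeff_X_pow, if_neg (by lia), mul_zero]

lemma hasExactPeriod_of_forall_ne {g : ℕ → ℚ} {d : ℕ} (hd : 0 < d) (hper : Function.Periodic g d)
    (hne : ∀ r, 0 < r → r < d → g r ≠ g 0) : HasExactPeriod g d := by
  refine ⟨⟨hd, hper⟩, fun r ⟨hr, hrper⟩ => ?_⟩
  by_contra! hlt
  exact hne r hr hlt hrper.eq

end Quasipolynomials

lemma pos_of_le_of_coprime {c d : ℕ} (hcd : c ≤ d) (hcop : Nat.Coprime c d) : 0 < d := by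
  refine Nat.pos_of_ne_zero ?_
  rintro rfl
  obtain rfl := Nat.le_zero.1 hcd
  exact absurd hcop (by decide)

lemma hasExactPeriod_add_mul_mod {c d : ℕ} (hd : 0 < d) (hcop : Nat.Coprime c d) {g : ℕ → ℚ}
    {K a : ℚ} (ha : a ≠ 0)
    (hg : ∀ n : ℕ, g n = K + a * (((n % d : ℕ) : ℚ) * ((d : ℚ) - ((n % d : ℕ) : ℚ)) *
      ((d : ℚ) - (c : ℚ)) / (2 * (d : ℚ) ^ 2))) : HasExactPeriod g d := by
  refine hasExactPeriod_of_forall_ne hd (fun n => by rw [hg, hg, Nat.add_mod_right])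
    fun r hr hrd => ?_
  have hdc : (d : ℚ) - c ≠ 0 := sub_ne_zero.2 fun h => by
    obtain rfl : d = c := Nat.cast_injective h
    have := (Nat.coprime_self d).1 hcop
    lia
  have hdr : (d : ℚ) - r ≠ 0 := sub_ne_zero.2 (Nat.cast_injective.ne hrd.ne')
  have hr₀ : (r : ℚ) ≠ 0 := Nat.cast_ne_zero.2 hr.ne'
  have hd₀ : (d : ℚ) ≠ 0 := Nat.cast_ne_zero.2 hd.ne'
  rw [hg, hg, Nat.mod_eq_of_lt hrd, Nat.zero_mod]
  simp [ha, hdc, hdr, hr₀, hd₀]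

theorem propositionP (c d q : ℕ) (hcd : c ≤ d) (hcop : Nat.Coprime c d) (hq : 2 ≤ q) :
    (∃ γ : ℕ → ℕ → ℚ, IsQuasipolynomialExpansion
        (fun n => (numNonattacking {((c : ℤ), (d : ℤ))} q n : ℚ)) (2 * q) γ) ∧
    ∀ γ : ℕ → ℕ → ℚ, IsQuasipolynomialExpansion
        (fun n => (numNonattacking {((c : ℤ), (d : ℤ))} q n : ℚ)) (2 * q) γ →
      HasExactPeriod (γ 3) d ∧
      ∃ K : ℚ, ∀ n : ℕ, γ 3 n = K +
        -(1 / ((q - 2).factorial : ℚ)) *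
          (((n % d : ℕ) : ℚ) * ((d : ℚ) - ((n % d : ℕ) : ℚ)) * ((d : ℚ) - (c : ℚ))
            / (2 * (d : ℚ) ^ 2)) := by
  have hd := pos_of_le_of_coprime hcd hcop
  have hd₀ : (d : ℚ) ≠ 0 := Nat.cast_ne_zero.2 hd.ne'
  obtain ⟨q, rfl⟩ := Nat.exists_eq_add_of_le' hq
  have heval : ∀ n : ℕ, (numNonattacking {((c : ℤ), (d : ℤ))} (q + 2) n : ℚ) =
      (placementPoly c d (n % d : ℕ) (q + 2)).eval (n : ℚ) :=
    fun n => (eval_placementPoly hcd hcop hd (q + 2) n).symm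
  let P := fun r : ℕ => placementPoly c d r (q + 2)
  refine ⟨⟨_, isQuasipolynomialExpansion_coeff (P := P) hd
    (fun r => natDegree_placementPoly_le c d r (q + 2)) heval⟩, fun γ hγ => ?_⟩
  have hγ₃ : ∀ n, γ 3 n = (placementPoly c d 0 (q + 2)).coeff (2 * q + 1) +
      -(1 / (q.factorial : ℚ)) * (((n % d : ℕ) : ℚ) * ((d : ℚ) - ((n % d : ℕ) : ℚ)) *
        ((d : ℚ) - (c : ℚ)) / (2 * (d : ℚ) ^ 2)) := fun n => by
    rw [hγ.eq_coeff (P := P) hd heval (by lia), show 2 * (q + 2) - 3 = 2 * q + 1 by lia,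
      coeff_placementPoly hd₀]
    field_simp
    ring
  exact ⟨hasExactPeriod_add_mul_mod hd hcop (by simp [q.factorial_ne_zero]) hγ₃, _, hγ₃⟩
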